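/- Let $\mathsf k$ be a field and let $q\ge 2$ be an integer. Let $\mathbb L^2_q$ be the simplicial complex on the $\binom{q+1}{2}$ vertices $\ell_{i,j}=\ell_{j,i}$ ($1\le i\le j\le q$) whose faces are the nonempty subsets of the sets $\{\ell_{i,j} : 1\le j\le q\}$, for $1\le i\le q$, and of the set $\{\ell_{i,j} : 1\le i<j\le q\}$. Let $I\subset S=\mathsf k[x_1,\dots,x_n]$ be an ideal minimally generated by $q$ square-free monomials $m_1,\dots,m_q$. For each $d \geq 0$ let $\beta_d(I^2)$ be the $d$-th Betti number of the $S$-module $I^2$, that is, the smallest rank of the $d$-th free module (counting from $0$) in a resolution of $I^2$ by free $S$-modules of finite rank. Call a vertex of $\mathbb L^2_q$ deleted if it arises as follows from indices $i,j,u,v\in\{1,\dots,q\}$ with $\{i,j\}\neq\{u,v\}$ and $m_im_j\mid m_um_v$: the vertex $\ell_{i,j}$ is deleted if $m_im_j=m_um_v$ and $i=\min\{i,j,u,v\}$, and the vertex $\ell_{u,v}$ is deleted if $m_im_j\ne m_um_v$. Let $t_i$ be the number of deleted vertices of the form $\ell_{i,j}$, $1\le j\le q$, and let $s$ be the minimal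 number of generators of $I^2$. Then for every $d\ge 0$ (a) $\displaystyle \beta_d(I^2)\le\binom{\frac12 q(q-1)}{d+1}+q\binom{q-1}{d},$ and the right-hand side is the number of $d$-dimensional faces of $\mathbb L^2_q$; moreover (b) $\displaystyle \beta_d(I^2)\le\binom{s-q}{d+1}+\sum_{i=1}^q\binom{q-1-t_i}{d}.$ The bound (a) is sharp: for every field $\mathsf k$ and every $q\ge 2$ there are an $n$ and an ideal of $\mathsf k[x_1,\dots,x_n]$ minimally generated by $q$ square-free monomials for which equality holds in (a) for all $d\ge 0$ simultaneously. -/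

import Mathlib

/-- A resolution of the `R`-module `M` by free modules of finite rank: an exact sequence
`⋯ → R ^ rank 2 → R ^ rank 1 → R ^ rank 0 → M → 0`. -/
structure FreeResolution (R : Type*) [CommRing R] (M : Type*) [AddCommGroup M] [Module R M] where
  /-- the rank of the free module in position `i` -/
  rank : ℕ → ℕ
  /-- the differential from position `i + 1` to position `i` -/
  d : ∀ i, (Fin (rank (i + 1)) → R) →ₗ[R] (Fin (rank i) → R)
  /-- the augmentation -/
  aug : (Fin (rank 0) → R) →ₗ[R] M
  aug_surjective : Function.Surjective aug
  exact_aug : Function.Exact (d 0) aug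
  exact_d : ∀ i, Function.Exact (d (i + 1)) (d i)

/-- The `i`-th Betti number of `M`: the smallest rank that the free module in position `i` has in
any free resolution of `M`. It is an extended natural number, so that it would be `⊤` (and not a
junk value `0`) for a module without a resolution by free modules of finite rank. -/
noncomputable def bettiNumber (R : Type*) [CommRing R] (M : Type*) [AddCommGroup M] [Module R M]
    (i : ℕ) : ℕ∞ :=
  ⨅ F : FreeResolution R M, (F.rank i : ℕ∞)

/-- The ideal `I` of `k[x₁, …, xₙ]` is minimally generated by the `q` square-free monomials whose
exponent vectors are `m 0, …, m (q - 1)`: they are square-free, they generate `I`, and none of them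
lies in the ideal generated by the others. -/
structure IsMinimallyGeneratedBySquarefree {k : Type*} [Field k] {n q : ℕ}
    (I : Ideal (MvPolynomial (Fin n) k)) (m : Fin q → Fin n →₀ ℕ) : Prop where
  squarefree : ∀ i x, m i x ≤ 1
  span_eq : Ideal.span (Set.range fun i => MvPolynomial.monomial (m i) (1 : k)) = I
  minimal : ∀ i, MvPolynomial.monomial (m i) (1 : k) ∉
    Ideal.span ((fun j => MvPolynomial.monomial (m j) (1 : k)) '' {j | j ≠ i})

/-- The simplicial complex whose faces are the nonempty subsets of members of `S`. -/
def complexSpannedBy {V : Type*} (S : Set (Finset V)) : PreAbstractSimplicialComplex V where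
  faces := {F | F.Nonempty ∧ ∃ G ∈ S, F ⊆ G}
  isRelLowerSet_faces := fun {_} hF =>
    ⟨hF.1, fun _ hle hne => ⟨hne, hF.2.imp fun _ hG => ⟨hG.1, hle.trans hG.2⟩⟩⟩

/-- The complex `𝕃²_q`. The vertex `ℓ_{i,j} = ℓ_{j,i}` is the unordered pair `s(i, j)`, where
`i = j` is allowed. The complex is spanned by the sets `{ℓ_{i,j} : 1 ≤ j ≤ q}`, one for each `i`,
and by the set `{ℓ_{i,j} : i < j}`. -/
def complexL2 (q : ℕ) : PreAbstractSimplicialComplex (Sym2 (Fin q)) :=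
  complexSpannedBy (insert (Finset.univ.filter fun v => ¬ v.IsDiag)
    (Set.range fun i => Finset.univ.filter fun v => i ∈ v))

/-- The number of faces of dimension `d`, that is, with `d + 1` vertices. -/
noncomputable def numFaces {V : Type*} (K : PreAbstractSimplicialComplex V) (d : ℕ) : ℕ :=
  {F | F ∈ K.faces ∧ F.card = d + 1}.ncard

/-- The vertices of `𝕃²_q` that are deleted in the construction of `𝕃²(I)`, for `I` with the
minimal square-free monomial generators `m 0, …, m (q - 1)`. Monomials are exponent vectors, so that
`m i + m j` is the label `mᵢ mⱼ` of `ℓ_{i,j}` and `≤` is divisibility of monomials. Whenever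
`{i, j} ≠ {u, v}` and `mᵢ mⱼ` divides `mᵤ mᵥ`, one deletes `ℓ_{i,j}` if `mᵢ mⱼ = mᵤ mᵥ` and
`i = min {i, j, u, v}`, and one deletes `ℓ_{u,v}` if `mᵢ mⱼ ≠ mᵤ mᵥ`. -/
def deletedVertices {n q : ℕ} (m : Fin q → Fin n →₀ ℕ) : Set (Sym2 (Fin q)) :=
  {w | ∃ i j u v : Fin q, s(i, j) ≠ s(u, v) ∧ m i + m j ≤ m u + m v ∧
    ((m i + m j = m u + m v ∧ i ≤ j ∧ i ≤ u ∧ i ≤ v ∧ w = s(i, j)) ∨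
      (m i + m j ≠ m u + m v ∧ w = s(u, v)))}

/-- The number `tᵢ` of deleted vertices of the form `ℓ_{i,j}`. -/
noncomputable def numDeletedAt {n q : ℕ} (m : Fin q → Fin n →₀ ℕ) (i : Fin q) : ℕ :=
  {w | w ∈ deletedVertices m ∧ i ∈ w}.ncard

-- Order the generators of `I ^ 2` so that the products `mᵢ mⱼ` with `i ≠ j` that survive deletion
-- come before the squares `mᵢ²`. Adding a monomial `f` to an ideal `J` gives `0 → J → (J, f) → S/(J
-- : f) → 0`, and the horseshoe lemma adds the ranks of resolutions. The surviving products are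
-- handled by a Taylor resolution, built in this same way. The decisive point is that when `mᵢ²` is
-- added, the colon ideal is generated by the quotients `mⱼ / gcd(mᵢ, mⱼ)` over the surviving
-- `ℓ_{i,j}` alone (`exists_notMem_deletedVertices`), so each square costs only a Taylor resolution
-- on the star of `i`. The total `hasBetti_sq` gives (a) and (b).
--
-- For sharpness, take one variable for each vertex of `𝕃²_q`, dividing exactly the generators
-- indexed by its endpoints. Each `f` then has a variable of larger exponent than all earlier
-- generators. Dropping one factor of it leaves `J : f` unchanged, so the extension is a multiple by
-- that variable and the horseshoe resolution stays minimal (`HasBetti.add`). Minimal resolutions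
-- have the smallest ranks (`HasBetti.le_of_retract`).
--
-- Both halves share one construction: `𝔪 = ⊤` imposes no minimality and yields upper bounds, while
-- the ideal of the variables yields the lower bound.

universe u

/-- A linear map from a finite free module onto `M` whose kernel lies in `𝔪` times the free
module. For `𝔪 = ⊤` the second condition is void. -/
def IsCover {R : Type u} [CommRing R] (𝔪 : Ideal R) {M : Type u} [AddCommGroup M] [Module R M]
    {ι : Type} (f : (ι → R) →ₗ[R] M) : Prop :=
  Function.Surjective f ∧ ∀ y, f y = 0 → ∀ j, y j ∈ 𝔪

/-- There is a partial resolution of `M` by finite free modules, up to position `d`, which has rank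
`b` in position `d` and is minimal with respect to `𝔪`. -/
def HasBetti {R : Type u} [CommRing R] (𝔪 : Ideal R) :
    ℕ → (M : Type u) → [AddCommGroup M] → [Module R M] → ℕ → Prop
  | 0, M, _, _, b => ∃ (ι : Type) (_ : Fintype ι) (f : (ι → R) →ₗ[R] M),
      IsCover 𝔪 f ∧ Fintype.card ι = b
  | d + 1, M, _, _, b => ∃ (ι : Type) (_ : Fintype ι) (f : (ι → R) →ₗ[R] M),
      IsCover 𝔪 f ∧ HasBetti 𝔪 d (LinearMap.ker f) b

/-! ### Minimal horseshoe lemma -/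

section Homological

variable {R : Type u} [CommRing R] {𝔪 : Ideal R}

theorem IsCover.equiv_comp {M N : Type u} [AddCommGroup M] [Module R M] [AddCommGroup N]
    [Module R N] (e : M ≃ₗ[R] N) {ι : Type} {f : (ι → R) →ₗ[R] M} (hf : IsCover 𝔪 f) :
    IsCover 𝔪 (e.toLinearMap ∘ₗ f) :=
  ⟨e.surjective.comp hf.1, fun y hy => hf.2 y (by simpa using hy)⟩

theorem HasBetti.of_equiv {d b : ℕ} {M N : Type u} [AddCommGroup M] [Module R M] [AddCommGroup N]
    [Module R N] (e : M ≃ₗ[R] N) (h : HasBetti 𝔪 d M b) : HasBetti 𝔪 d N b := by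
  cases d with
  | zero =>
    obtain ⟨ι, _, f, hf, hb⟩ := h
    exact ⟨ι, _, _, hf.equiv_comp e, hb⟩
  | succ d =>
    obtain ⟨ι, hι, f, hf, hb⟩ := h
    refine ⟨ι, hι, _, hf.equiv_comp e, ?_⟩
    rw [LinearEquiv.ker_comp]
    exact hb

theorem HasBetti.of_subsingleton {d : ℕ} {M : Type u} [AddCommGroup M] [Module R M]
    [Subsingleton M] : HasBetti 𝔪 d M 0 := by
  induction d generalizing M with
  | zero =>
    exact ⟨Empty, inferInstance, 0, ⟨fun y => ⟨0, Subsingleton.elim _ _⟩, fun _ _ j => j.elim⟩,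
      by simp⟩
  | succ d ih =>
    exact ⟨Empty, inferInstance, 0, ⟨fun y => ⟨0, Subsingleton.elim _ _⟩, fun _ _ j => j.elim⟩, ih⟩

/-- The cover of an extension that is built from covers of its two ends. -/
def extensionCover {M' M Mt : Type u} [AddCommGroup M'] [Module R M'] [AddCommGroup M] [Module R M]
    [AddCommGroup Mt] [Module R Mt] {ι κ : Type} (i : M' →ₗ[R] M) (φ : Mt →ₗ[R] M)
    (f : (ι → R) →ₗ[R] M') (s : (κ → R) →ₗ[R] Mt) : (ι ⊕ κ → R) →ₗ[R] M :=
  i ∘ₗ f ∘ₗ LinearMap.funLeft R R Sum.inl + φ ∘ₗ s ∘ₗ LinearMap.funLeft R R Sum.inr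

theorem extensionCover_apply {M' M Mt : Type u} [AddCommGroup M'] [Module R M'] [AddCommGroup M]
    [Module R M] [AddCommGroup Mt] [Module R Mt] {ι κ : Type} (i : M' →ₗ[R] M) (φ : Mt →ₗ[R] M)
    (f : (ι → R) →ₗ[R] M') (s : (κ → R) →ₗ[R] Mt) (y : ι ⊕ κ → R) :
    extensionCover i φ f s y = i (f (y ∘ Sum.inl)) + φ (s (y ∘ Sum.inr)) := rfl

/-- An extension `M` of `M''` by `M'` together with an extension `Mt` of `M''` by `M'` of which the
former is the multiple by `x`. -/
structure IsMultipleExtension (x : R) {M' M M'' Mt : Type u} [AddCommGroup M'] [Module R M']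
    [AddCommGroup M] [Module R M] [AddCommGroup M''] [Module R M''] [AddCommGroup Mt] [Module R Mt]
    (i : M' →ₗ[R] M) (p : M →ₗ[R] M'') (it : M' →ₗ[R] Mt) (φ : Mt →ₗ[R] M) : Prop where
  inj : Function.Injective i
  exact : ∀ y, p y = 0 ↔ ∃ z, i z = y
  inj_t : Function.Injective it
  exact_t : ∀ y, p (φ y) = 0 → ∃ z, it z = y
  surj : ∀ z, ∃ y, p (φ y) = z
  comp : ∀ z, φ (it z) = x • i z

variable {x : R} {M' M M'' Mt : Type u} [AddCommGroup M'] [Module R M']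
    [AddCommGroup M] [Module R M] [AddCommGroup M''] [Module R M''] [AddCommGroup Mt] [Module R Mt]
    {i : M' →ₗ[R] M} {p : M →ₗ[R] M''} {it : M' →ₗ[R] Mt} {φ : Mt →ₗ[R] M}

/-- The lift of `g` goes through `φ`, not directly to `M`. For `b` in the kernel of `g`, `φ (s b)`
is then `x` times an element of `M'`, so up to the kernel of `f` the coordinates over `M'` of a
relation are multiples of `x`. -/
theorem IsMultipleExtension.isCover (h : IsMultipleExtension x i p it φ) (hx : x ∈ 𝔪) {ι κ : Type}
    {f : (ι → R) →ₗ[R] M'} {g : (κ → R) →ₗ[R] M''} (hf : IsCover 𝔪 f) (hg : IsCover 𝔪 g)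
    {s : (κ → R) →ₗ[R] Mt} (hs : ∀ y, p (φ (s y)) = g y) :
    IsCover 𝔪 (extensionCover i φ f s) := by
  refine ⟨fun y => ?_, fun y hy => ?_⟩
  · obtain ⟨b, hb⟩ := hg.1 (p y)
    obtain ⟨z, hz⟩ := (h.exact (y - φ (s b))).1 (by rw [map_sub, hs, hb, sub_self])
    obtain ⟨a, rfl⟩ := hf.1 z
    refine ⟨Sum.elim a b, ?_⟩
    rw [extensionCover_apply, Sum.elim_comp_inl, Sum.elim_comp_inr, hz, sub_add_cancel]
  · rw [extensionCover_apply] at hy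
    have hg0 : g (y ∘ Sum.inr) = 0 := by
      rw [← hs, ← zero_add (p _), ← (h.exact _).2 ⟨f (y ∘ Sum.inl), rfl⟩, ← map_add, hy, map_zero,
        (h.exact _).2 ⟨f (y ∘ Sum.inl), rfl⟩]
    obtain ⟨z, hz⟩ := h.exact_t (s (y ∘ Sum.inr)) (by rw [hs, hg0])
    obtain ⟨a, rfl⟩ := hf.1 z
    have hk : f (y ∘ Sum.inl + x • a) = 0 := by
      apply h.inj
      rw [map_add, map_smul, map_add, map_smul, ← h.comp, hz, hy, map_zero]
    rintro (j | j)
    · have := hf.2 _ hk j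
      exact (Ideal.add_mem_iff_left _ (𝔪.mul_mem_right (a j) hx)).1 this
    · exact hg.2 _ hg0 j

/-- The hypothesis passes to first syzygies, which drives the induction: both extensions get
horseshoe covers from the same `f` and `s`, and `φ` lifts to the map scaling the coordinates over
`M'` by `x`. -/
theorem IsMultipleExtension.ker (h : IsMultipleExtension x i p it φ) {ι κ : Type}
    {f : (ι → R) →ₗ[R] M'} {g : (κ → R) →ₗ[R] M''} (hf : Function.Surjective f)
    {s : (κ → R) →ₗ[R] Mt} (hs : ∀ y, p (φ (s y)) = g y) :
    ∃ (i₁ : LinearMap.ker f →ₗ[R] LinearMap.ker (extensionCover i φ f s))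
      (p₁ : LinearMap.ker (extensionCover i φ f s) →ₗ[R] LinearMap.ker g)
      (it₁ : LinearMap.ker f →ₗ[R] LinearMap.ker (extensionCover it LinearMap.id f s))
      (φ₁ : LinearMap.ker (extensionCover it LinearMap.id f s) →ₗ[R]
        LinearMap.ker (extensionCover i φ f s)), IsMultipleExtension x i₁ p₁ it₁ φ₁ := by
  have hpi : ∀ z, p (i z) = 0 := fun z => (h.exact _).2 ⟨z, rfl⟩
  let inlMap : (ι → R) →ₗ[R] (ι ⊕ κ → R) :=
    { toFun := fun y => Sum.elim y 0
      map_add' := fun y z => by ext (j | j) <;> simp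
      map_smul' := fun c y => by ext (j | j) <;> simp }
  let scale : (ι ⊕ κ → R) →ₗ[R] (ι ⊕ κ → R) :=
    { toFun := fun y => Sum.elim (x • (y ∘ Sum.inl)) (y ∘ Sum.inr)
      map_add' := fun y z => by ext (j | j) <;> simp [mul_add]
      map_smul' := fun c y => by ext (j | j) <;> simp [mul_left_comm] }
  refine ⟨inlMap.restrict fun y hy => ?_, (LinearMap.funLeft R R Sum.inr).restrict fun y hy => ?_,
    inlMap.restrict fun y hy => ?_, scale.restrict fun y hy => ?_, ?_⟩
  · have hy : f y = 0 := hy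
    simp [inlMap, extensionCover_apply, hy]
  · have hy : i (f (y ∘ Sum.inl)) + φ (s (y ∘ Sum.inr)) = 0 := hy
    have := congrArg p hy
    rw [map_add, hpi, zero_add, hs, map_zero] at this
    exact this
  · have hy : f y = 0 := hy
    simp [inlMap, extensionCover_apply, hy]
  · have hy : it (f (y ∘ Sum.inl)) + s (y ∘ Sum.inr) = 0 := hy
    have := congrArg φ hy
    rw [map_add, h.comp, map_zero] at this
    simpa [scale, extensionCover_apply] using this
  · have key : ∀ y : ι ⊕ κ → R, y ∘ Sum.inr = 0 → y = Sum.elim (y ∘ Sum.inl) 0 := by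
      intro y hy
      rw [← hy, Sum.elim_comp_inl_inr]
    refine ⟨?_, ?_, ?_, ?_, ?_, ?_⟩
    · rintro ⟨y, hy⟩ ⟨z, hz⟩ hyz
      have := congrArg (fun w => w.1 ∘ Sum.inl) hyz
      exact Subtype.ext this
    · rintro ⟨y, hy⟩
      constructor
      · intro h0
        have h0 : y ∘ Sum.inr = 0 := congrArg Subtype.val h0
        refine ⟨⟨y ∘ Sum.inl, ?_⟩, Subtype.ext (key y h0).symm⟩
        have hy : i (f (y ∘ Sum.inl)) + φ (s (y ∘ Sum.inr)) = 0 := hy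
        apply h.inj
        rw [h0] at hy
        simpa using hy
      · rintro ⟨z, hz⟩
        have hz : Sum.elim z.1 0 = y := congrArg Subtype.val hz
        subst hz
        exact Subtype.ext rfl
    · rintro ⟨y, hy⟩ ⟨z, hz⟩ hyz
      have := congrArg (fun w => w.1 ∘ Sum.inl) hyz
      exact Subtype.ext this
    · rintro ⟨y, hy⟩ h0
      have h0 : y ∘ Sum.inr = 0 := congrArg Subtype.val h0
      refine ⟨⟨y ∘ Sum.inl, ?_⟩, Subtype.ext (key y h0).symm⟩
      have hy : it (f (y ∘ Sum.inl)) + s (y ∘ Sum.inr) = 0 := hy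
      apply h.inj_t
      rw [h0] at hy
      simpa using hy
    · rintro ⟨b, hb⟩
      have hb : g b = 0 := hb
      obtain ⟨z, hz⟩ := h.exact_t (s b) (by rw [hs, hb])
      obtain ⟨a, rfl⟩ := hf z
      refine ⟨⟨Sum.elim (-a) b, ?_⟩, Subtype.ext rfl⟩
      change it (f (-a)) + s b = 0
      rw [map_neg, map_neg, hz, neg_add_cancel]
    · rintro ⟨y, hy⟩
      apply Subtype.ext
      ext (j | j)
      · rfl
      · change (0 : R) = x * 0
        rw [mul_zero]

/-- The horseshoe lemma: Betti numbers with respect to `𝔪` are additive on an extension that is a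
multiple by an element of `𝔪`. -/
theorem HasBetti.add {d b b' : ℕ} (hx : x ∈ 𝔪) (h : IsMultipleExtension x i p it φ)
    (h₁ : HasBetti 𝔪 d M' b) (h₂ : HasBetti 𝔪 d M'' b') : HasBetti 𝔪 d M (b + b') := by
  induction d generalizing M' M M'' Mt with
  | zero =>
    obtain ⟨ι, _, f, hf, rfl⟩ := h₁
    obtain ⟨κ, _, g, hg, rfl⟩ := h₂
    obtain ⟨s, hs⟩ := Module.projective_lifting_property (p ∘ₗ φ) g h.surj
    exact ⟨ι ⊕ κ, inferInstance, _, h.isCover hx hf hg (LinearMap.congr_fun hs), by simp⟩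
  | succ d ih =>
    obtain ⟨ι, _, f, hf, hb⟩ := h₁
    obtain ⟨κ, _, g, hg, hb'⟩ := h₂
    obtain ⟨s, hs⟩ := Module.projective_lifting_property (p ∘ₗ φ) g h.surj
    obtain ⟨i₁, p₁, it₁, φ₁, h'⟩ := h.ker hf.1 (LinearMap.congr_fun hs)
    exact ⟨ι ⊕ κ, inferInstance, _, h.isCover hx hf hg (LinearMap.congr_fun hs), ih h' hb hb'⟩

end Homological

/-! ### Minimal resolutions have the smallest ranks -/

section Comparison

variable {R : Type u} [CommRing R] {𝔪 : Ideal R}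

/-- Elements of a free module with coordinates in `𝔪` are mapped into `𝔪` times the target. -/
theorem map_mem_of_coord_mem {ι κ : Type} [Fintype ι] (f : (ι → R) →ₗ[R] (κ → R)) {y : ι → R}
    (hy : ∀ j, y j ∈ 𝔪) (l : κ) : f y l ∈ 𝔪 := by
  classical
  rw [LinearMap.pi_apply_eq_sum_univ f y, Finset.sum_apply]
  exact 𝔪.sum_mem fun j _ => 𝔪.mul_mem_right _ (hy j)

/-- Modulo `𝔪` the map becomes surjective between free modules over a nontrivial commutative ring.
-/
theorem card_le_card_of_sub_mem [𝔪.IsPrime] {ι κ : Type} [Fintype ι] [Fintype κ]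
    (f : (κ → R) →ₗ[R] (ι → R)) (h : ∀ y : ι → R, ∃ z, ∀ j, y j - f z j ∈ 𝔪) :
    Fintype.card ι ≤ Fintype.card κ := by
  classical
  let A : Matrix ι κ (R ⧸ 𝔪) := (LinearMap.toMatrix' f).map (Ideal.Quotient.mk 𝔪)
  apply card_le_of_surjective (R ⧸ 𝔪) (Matrix.toLin' A)
  intro y
  choose y' hy' using fun j => Ideal.Quotient.mk_surjective (y j)
  obtain ⟨z, hz⟩ := h y'
  refine ⟨fun l => Ideal.Quotient.mk 𝔪 (z l), ?_⟩
  ext j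
  have h1 : f z j = ∑ l, LinearMap.toMatrix' f j l * z l := by
    conv_lhs => rw [← LinearMap.toMatrix'_mulVec f z]
    rfl
  rw [← hy' j, Matrix.toLin'_apply, (Ideal.Quotient.mk_eq_mk_iff_sub_mem _ _).2 (hz j), h1, map_sum]
  simp [Matrix.mulVec, dotProduct, A]

/-- A minimal resolution has the smallest ranks: comparison of a minimal and an arbitrary
resolution of modules `M` and `N` with maps `u : M → N` and `v : N → M`, for which `v ∘ u` differs
from the identity by a map `M → P → M` that factors through `𝔪` times the free module `P`. -/
theorem HasBetti.le_of_retract [𝔪.IsPrime] {d b c : ℕ} {M N : Type u} [AddCommGroup M] [Module R M]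
    [AddCommGroup N] [Module R N] (hM : HasBetti 𝔪 d M b) (hN : HasBetti (⊤ : Ideal R) d N c)
    (u : M →ₗ[R] N) (v : N →ₗ[R] M) {ν : Type} [Fintype ν] (j : M →ₗ[R] (ν → R))
    (g : (ν → R) →ₗ[R] M) (hj : ∀ y l, j y l ∈ 𝔪) (h : ∀ y, v (u y) = y + g (j y)) : b ≤ c := by
  induction d generalizing M N ν with
  | zero =>
    obtain ⟨ι, _, π, hπ, rfl⟩ := hM
    obtain ⟨κ, _, ρ, hρ, rfl⟩ := hN
    obtain ⟨γ, hγ⟩ := Module.projective_lifting_property π (v ∘ₗ ρ) hπ.1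
    obtain ⟨g', hg'⟩ := Module.projective_lifting_property π g hπ.1
    refine card_le_card_of_sub_mem (𝔪 := 𝔪) γ fun y => ?_
    obtain ⟨z, hz⟩ := hρ.1 (u (π y))
    refine ⟨z, fun l => ?_⟩
    have h0 : π (y - γ z + g' (j (π y))) = 0 := by
      have e1 := LinearMap.congr_fun hγ z
      have e2 := LinearMap.congr_fun hg' (j (π y))
      simp only [LinearMap.comp_apply] at e1 e2
      rw [map_add, map_sub, e1, e2, hz, h]
      abel
    exact (Ideal.add_mem_iff_left _ (map_mem_of_coord_mem g' (hj _) l)).1 (hπ.2 _ h0 l)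
  | succ d ih =>
    obtain ⟨ι, _, π, hπ, hb⟩ := hM
    obtain ⟨κ, _, ρ, hρ, hc⟩ := hN
    obtain ⟨α, hα⟩ := Module.projective_lifting_property ρ (u ∘ₗ π) hρ.1
    obtain ⟨β, hβ⟩ := Module.projective_lifting_property π (v ∘ₗ ρ) hπ.1
    obtain ⟨g', hg'⟩ := Module.projective_lifting_property π g hπ.1
    have hα := LinearMap.congr_fun hα
    have hβ := LinearMap.congr_fun hβ
    have hg' := LinearMap.congr_fun hg'
    simp only [LinearMap.comp_apply] at hα hβ hg'
    -- On `ker π` the term through `j` vanishes, so `β ∘ α` is the identity plus `ζ`. The new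
    -- factorization passes through the inclusion of `ker π`, whose coordinates lie in `𝔪` by
    -- minimality.
    let ζ : (ι → R) →ₗ[R] LinearMap.ker π :=
      (β ∘ₗ α - LinearMap.id - g' ∘ₗ j ∘ₗ π).codRestrict _ fun y => by
        simp only [LinearMap.mem_ker, LinearMap.sub_apply, LinearMap.comp_apply, LinearMap.id_apply,
          map_sub, hα, hβ, hg', h]
        abel
    refine ih hb hc (α.restrict fun y hy => ?_) (β.restrict fun y hy => ?_)
      (LinearMap.ker π).subtype ζ (fun y l => hπ.2 _ y.2 l) fun y => ?_
    · rw [LinearMap.mem_ker] at hy ⊢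
      rw [hα, hy, map_zero]
    · rw [LinearMap.mem_ker] at hy ⊢
      rw [hβ, hy, map_zero]
    · apply Subtype.ext
      have hy : π y.1 = 0 := y.2
      change β (α y.1) = y.1 + (β (α y.1) - y.1 - g' (j (π y.1)))
      rw [hy, map_zero, map_zero]
      abel

theorem HasBetti.le_of_minimal [𝔪.IsPrime] {d b c : ℕ} {M : Type u} [AddCommGroup M] [Module R M]
    (h : HasBetti 𝔪 d M b) (h' : HasBetti (⊤ : Ideal R) d M c) : b ≤ c :=
  h.le_of_retract h' LinearMap.id LinearMap.id (ν := Empty) 0 0 (fun _ l => l.elim) (by simp)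

end Comparison

/-! ### Partial and complete free resolutions -/

namespace FreeResolution

variable {R : Type u} [CommRing R] {M : Type u} [AddCommGroup M] [Module R M]

/-- The resolution of the first syzygy module. -/
def tail (F : FreeResolution R M) : FreeResolution R (LinearMap.ker F.aug) where
  rank i := F.rank (i + 1)
  d i := F.d (i + 1)
  aug := (F.d 0).codRestrict _ fun y => (F.exact_aug _).2 ⟨y, rfl⟩
  aug_surjective := by
    rintro ⟨y, hy⟩
    obtain ⟨z, hz⟩ := (F.exact_aug y).1 hy
    exact ⟨z, Subtype.ext hz⟩
  exact_aug y := by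
    rw [← F.exact_d 0 y, Subtype.ext_iff]
    rfl
  exact_d i := F.exact_d (i + 1)

theorem hasBetti (F : FreeResolution R M) (d : ℕ) : HasBetti (⊤ : Ideal R) d M (F.rank d) := by
  induction d generalizing M with
  | zero => exact ⟨Fin (F.rank 0), inferInstance, F.aug,
      ⟨F.aug_surjective, fun _ _ _ => trivial⟩, by simp⟩
  | succ d ih => exact ⟨Fin (F.rank 0), inferInstance, F.aug,
      ⟨F.aug_surjective, fun _ _ _ => trivial⟩, ih F.tail⟩

/-- Prepend a cover to a resolution of its kernel. -/
def cons {n : ℕ} (f : (Fin n → R) →ₗ[R] M) (hf : Function.Surjective f)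
    (F : FreeResolution R (LinearMap.ker f)) : FreeResolution R M where
  rank i := Nat.casesOn i n F.rank
  d i := Nat.casesOn i ((LinearMap.ker f).subtype ∘ₗ F.aug) F.d
  aug := f
  aug_surjective := hf
  exact_aug y := by
    constructor
    · intro hy
      obtain ⟨z, hz⟩ := F.aug_surjective ⟨y, hy⟩
      exact ⟨z, congrArg Subtype.val hz⟩
    · rintro ⟨z, rfl⟩
      exact (F.aug z).2
  exact_d i := by
    cases i with
    | zero =>
      intro y
      rw [← F.exact_aug y]
      exact (Subtype.ext_iff (a1 := F.aug y) (a2 := 0)).symm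
    | succ i => exact F.exact_d i

variable (R M)

theorem nonempty_of_finite [IsNoetherianRing R] [Module.Finite R M] :
    Nonempty (FreeResolution R M) := by
  have cov : ∀ (t : Σ n, Submodule R (Fin n → R)), ∃ (m : ℕ) (f : (Fin m → R) →ₗ[R] (Fin t.1 → R)),
      LinearMap.range f = t.2 := by
    rintro ⟨n, N⟩
    obtain ⟨m, f, hf⟩ := Module.Finite.exists_fin' R N
    exact ⟨m, N.subtype ∘ₗ f, by
      rw [LinearMap.range_comp, LinearMap.range_eq_top.2 hf, Submodule.map_top, N.range_subtype]⟩
  choose m f hf using cov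
  obtain ⟨n, g, hg⟩ := Module.Finite.exists_fin' R M
  -- The state is a rank together with the submodule of that free module still to be covered.
  let st : ℕ → Σ n, Submodule R (Fin n → R) :=
    fun i => Nat.rec ⟨n, LinearMap.ker g⟩ (fun _ t => ⟨m t, LinearMap.ker (f t)⟩) i
  exact ⟨{ rank := fun i => (st i).1
           d := fun i => f (st i)
           aug := g
           aug_surjective := hg
           exact_aug := LinearMap.exact_iff.2 (hf (st 0)).symm
           exact_d := fun i => LinearMap.exact_iff.2 (hf (st (i + 1))).symm }⟩

variable {R M}

/-- Over a noetherian ring the last kernel of a partial resolution is finitely generated, so the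
resolution can be continued. -/
theorem exists_rank_eq [IsNoetherianRing R] {d b : ℕ} (h : HasBetti (⊤ : Ideal R) d M b) :
    ∃ F : FreeResolution R M, F.rank d = b := by
  have reindex : ∀ {N : Type u} [AddCommGroup N] [Module R N] {ι : Type} [Fintype ι]
      (f : (ι → R) →ₗ[R] N), ∃ e : (Fin (Fintype.card ι) → R) ≃ₗ[R] (ι → R),
      LinearMap.ker (f ∘ₗ e.toLinearMap) = (LinearMap.ker f).map e.symm.toLinearMap := fun f =>
    ⟨LinearEquiv.funCongrLeft R R (Fintype.equivFin _), by
      rw [LinearMap.ker_comp, Submodule.map_equiv_eq_comap_symm, LinearEquiv.symm_symm]⟩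
  induction d generalizing M with
  | zero =>
    obtain ⟨ι, _, f, hf, rfl⟩ := h
    obtain ⟨e, -⟩ := reindex f
    obtain ⟨F⟩ := nonempty_of_finite R (LinearMap.ker (f ∘ₗ e.toLinearMap))
    exact ⟨F.cons _ (hf.1.comp e.surjective), rfl⟩
  | succ d ih =>
    obtain ⟨ι, _, f, hf, hb⟩ := h
    obtain ⟨e, he⟩ := reindex f
    have hb' : HasBetti (⊤ : Ideal R) d (LinearMap.ker (f ∘ₗ e.toLinearMap)) b := by
      rw [he]
      exact hb.of_equiv (e.symm.submoduleMap _)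
    obtain ⟨F, rfl⟩ := ih hb'
    exact ⟨F.cons _ (hf.1.comp e.surjective), rfl⟩

end FreeResolution

/-! ### Bounds for Betti numbers -/

section BettiNumber

variable {R : Type u} [CommRing R] {M : Type u} [AddCommGroup M] [Module R M] {d b : ℕ}

theorem bettiNumber_le_of_hasBetti [IsNoetherianRing R] (h : HasBetti (⊤ : Ideal R) d M b) :
    bettiNumber R M d ≤ b := by
  obtain ⟨F, rfl⟩ := FreeResolution.exists_rank_eq h
  exact iInf_le _ F

theorem le_bettiNumber_of_hasBetti {𝔪 : Ideal R} [𝔪.IsPrime] (h : HasBetti 𝔪 d M b) :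
    (b : ℕ∞) ≤ bettiNumber R M d :=
  le_iInf fun F => Nat.cast_le.2 (h.le_of_minimal (F.hasBetti d))

/-- Compared with a minimal cover, this bounds the number of undeleted vertices by the number of
generators. -/
theorem hasBetti_spanFinrank {I : Ideal R} (hI : I.FG) :
    HasBetti (⊤ : Ideal R) 0 I I.spanFinrank := by
  have := (Submodule.FG.finite_generators hI).fintype
  let e := Fintype.equivFin I.generators
  let f := Fintype.linearCombination R fun j => (e.symm j : R)
  have hr : LinearMap.range f = I := by
    rw [Fintype.range_linearCombination, Set.range_comp' Subtype.val, e.symm.range_eq_univ,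
      Set.image_univ, Subtype.range_coe, I.span_generators]
  refine ⟨Fin _, inferInstance, f.codRestrict I fun y => hr.le ⟨y, rfl⟩,
    ⟨?_, fun _ _ _ => trivial⟩, ?_⟩
  · rintro ⟨y, hy⟩
    obtain ⟨z, hz⟩ := hr.ge hy
    exact ⟨z, Subtype.ext hz⟩
  · rw [Fintype.card_fin, ← Nat.card_eq_fintype_card]
    exact Submodule.FG.generators_ncard hI

end BettiNumber

/-! ### Shift between an ideal and its quotient ring -/

section Quotient

variable {R : Type u} [CommRing R] {𝔪 K : Ideal R}

theorem isCover_mkQ (hK : K ≤ 𝔪) :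
    IsCover 𝔪 (K.mkQ ∘ₗ (LinearEquiv.funUnique Unit R R).toLinearMap) := by
  refine ⟨K.mkQ_surjective.comp (LinearEquiv.funUnique Unit R R).surjective, fun y hy j => hK ?_⟩
  exact (Submodule.Quotient.mk_eq_zero K).1 hy

theorem hasBetti_quotient_zero (hK : K ≤ 𝔪) : HasBetti 𝔪 0 (R ⧸ K) 1 :=
  ⟨Unit, inferInstance, _, isCover_mkQ hK, by simp⟩

theorem hasBetti_quotient_succ (hK : K ≤ 𝔪) {d b : ℕ} (h : HasBetti 𝔪 d K b) :
    HasBetti 𝔪 (d + 1) (R ⧸ K) b := by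
  refine ⟨Unit, inferInstance, _, isCover_mkQ hK, ?_⟩
  rw [LinearMap.ker_comp, Submodule.ker_mkQ]
  exact h.of_equiv ((LinearEquiv.funUnique Unit R R).ofSubmodule' K).symm

end Quotient

/-! ### Adding a monomial generator; the Taylor resolution -/

section MonomialIdeal

open MvPolynomial

variable {k : Type u} [Field k] {σ : Type}

variable (k) in
/-- The ideal generated by the monomials with exponent vectors in `A`. -/
noncomputable def monomialIdeal (A : Set (σ →₀ ℕ)) : Ideal (MvPolynomial σ k) :=
  Ideal.span ((fun a => monomial a 1) '' A)

theorem mem_monomialIdeal {A : Set (σ →₀ ℕ)} {y : MvPolynomial σ k} :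
    y ∈ monomialIdeal k A ↔ ∀ s ∈ y.support, ∃ a ∈ A, a ≤ s :=
  mem_ideal_span_monomial_image

theorem monomial_mem_monomialIdeal {A : Set (σ →₀ ℕ)} {f : σ →₀ ℕ} :
    monomial f (1 : k) ∈ monomialIdeal k A ↔ ∃ a ∈ A, a ≤ f := by
  classical
  rw [mem_monomialIdeal]
  simp [support_monomial]

theorem mul_monomial_mem_monomialIdeal {A : Set (σ →₀ ℕ)} {y : MvPolynomial σ k} {f : σ →₀ ℕ} :
    y * monomial f 1 ∈ monomialIdeal k A ↔ ∀ s ∈ y.support, ∃ a ∈ A, a ≤ s + f := by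
  classical
  rw [mem_monomialIdeal]
  constructor
  · intro h s hs
    exact h _ (by simpa [mem_support_iff, coeff_mul_monomial] using hs)
  · intro h s hs
    rw [mem_support_iff, coeff_mul_monomial', mul_one] at hs
    split_ifs at hs with hf
    · simpa [tsub_add_cancel_of_le hf] using h _ (mem_support_iff.2 hs)
    · exact absurd rfl hs

theorem monomialIdeal_mono {A B : Set (σ →₀ ℕ)} (h : ∀ a ∈ A, ∃ b ∈ B, b ≤ a) :
    monomialIdeal k A ≤ monomialIdeal k B := by
  refine Ideal.span_le.2 ?_
  rintro _ ⟨a, ha, rfl⟩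
  exact monomial_mem_monomialIdeal.2 (h a ha)

variable (k) in
theorem monomialIdeal_le_insert (A : Set (σ →₀ ℕ)) (f : σ →₀ ℕ) :
    monomialIdeal k A ≤ monomialIdeal k (insert f A) :=
  monomialIdeal_mono fun a ha => ⟨a, Set.mem_insert_of_mem f ha, le_rfl⟩

theorem mem_monomialIdeal_insert {A : Set (σ →₀ ℕ)} {f : σ →₀ ℕ} {y : MvPolynomial σ k} :
    y ∈ monomialIdeal k (insert f A) ↔ ∃ c, ∃ z ∈ monomialIdeal k A, y = c * monomial f 1 + z := by
  rw [monomialIdeal, Set.image_insert_eq]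
  exact Ideal.mem_span_insert

variable {𝔪 : Ideal (MvPolynomial σ k)} {d b b' : ℕ}

/-- By `hh` the colon ideals of `(A)` by `h` and by `h + e` agree, so `(A, h)` and `(A, h + e)`
extend the same quotient by `(A)`; `φ` is multiplication by the monomial of `e`. -/
theorem isMultipleExtension_monomialIdeal {A : Set (σ →₀ ℕ)} {e h : σ →₀ ℕ}
    (hh : ∀ g, (∃ a ∈ A, a ≤ g + (h + e)) → ∃ a ∈ A, a ≤ g + h) :
    ∃ φ : monomialIdeal k (insert h A) →ₗ[MvPolynomial σ k] monomialIdeal k (insert (h + e) A),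
      IsMultipleExtension (monomial e (1 : k))
        (Submodule.inclusion (monomialIdeal_le_insert k _ _))
        ((monomialIdeal k A).submoduleOf (monomialIdeal k (insert (h + e) A))).mkQ
        (Submodule.inclusion (monomialIdeal_le_insert k _ _)) φ := by
  have hmul : ∀ c : MvPolynomial σ k, monomial e 1 * (c * monomial h 1) = c * monomial (h + e) 1 := by
    intro c
    rw [mul_left_comm, monomial_mul, one_mul, add_comm e h]
  let φ := (LinearMap.mulLeft (MvPolynomial σ k) (monomial e (1 : k))).restrict
    (p := monomialIdeal k (insert h A)) (q := monomialIdeal k (insert (h + e) A)) (by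
      intro y hy
      obtain ⟨c, z, hz, rfl⟩ := mem_monomialIdeal_insert.1 hy
      rw [LinearMap.mulLeft_apply, mul_add, hmul]
      exact mem_monomialIdeal_insert.2 ⟨c, _, Ideal.mul_mem_left _ _ hz, rfl⟩)
  have hker : ∀ y, ((monomialIdeal k A).submoduleOf (monomialIdeal k (insert (h + e) A))).mkQ y = 0 ↔
      y.1 ∈ monomialIdeal k A := fun y => by
    rw [Submodule.mkQ_apply, Submodule.Quotient.mk_eq_zero]
    rfl
  refine ⟨φ, Submodule.inclusion_injective _, ?_, Submodule.inclusion_injective _, ?_, ?_, ?_⟩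
  · intro y
    rw [hker]
    constructor
    · exact fun hy => ⟨⟨y, hy⟩, rfl⟩
    · rintro ⟨z, rfl⟩
      exact z.2
  · rintro ⟨y, hy⟩ h0
    rw [hker] at h0
    have h0 : monomial e 1 * y ∈ monomialIdeal k A := h0
    suffices y ∈ monomialIdeal k A from ⟨⟨y, this⟩, rfl⟩
    obtain ⟨c, z, hz, rfl⟩ := mem_monomialIdeal_insert.1 hy
    rw [mul_add, hmul, Ideal.add_mem_iff_left _ (Ideal.mul_mem_left _ _ hz),
      mul_monomial_mem_monomialIdeal] at h0
    rw [Ideal.add_mem_iff_left _ hz, mul_monomial_mem_monomialIdeal]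
    exact fun s hs => hh s (h0 s hs)
  · intro z
    obtain ⟨⟨y, hy⟩, rfl⟩ := Submodule.mkQ_surjective _ z
    obtain ⟨c, z, hz, rfl⟩ := mem_monomialIdeal_insert.1 hy
    refine ⟨⟨c * monomial h 1, mem_monomialIdeal_insert.2 ⟨c, 0, zero_mem _, by simp⟩⟩, ?_⟩
    rw [← sub_eq_zero, ← map_sub, hker]
    change monomial e 1 * (c * monomial h 1) - (c * monomial (h + e) 1 + z) ∈ monomialIdeal k A
    rw [hmul, sub_add_cancel_left]
    exact neg_mem hz
  · exact fun z => rfl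

/-- Betti numbers when a monomial generator `h * e` is added to a monomial ideal. The colon ideal is
generated by the monomials in `B`, and it does not change when the factor `e ∈ 𝔪` is dropped. -/
theorem hasBetti_monomialIdeal_insert {A B : Set (σ →₀ ℕ)} {e h : σ →₀ ℕ}
    (he : monomial e (1 : k) ∈ 𝔪)
    (hh : ∀ g, (∃ a ∈ A, a ≤ g + (h + e)) → ∃ a ∈ A, a ≤ g + h)
    (hB : ∀ g, (∃ a ∈ A, a ≤ g + (h + e)) ↔ ∃ b ∈ B, b ≤ g)
    (h₁ : HasBetti 𝔪 d (monomialIdeal k A) b)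
    (h₂ : HasBetti 𝔪 d (MvPolynomial σ k ⧸ monomialIdeal k B) b') :
    HasBetti 𝔪 d (monomialIdeal k (insert (h + e) A)) (b + b') := by
  obtain ⟨φ, hφ⟩ := isMultipleExtension_monomialIdeal (k := k) hh
  refine HasBetti.add he hφ h₁ (h₂.of_equiv ?_)
  let N := (monomialIdeal k A).submoduleOf (monomialIdeal k (insert (h + e) A))
  -- Multiplication by the new generator, modulo `(A)`: its kernel is the colon ideal.
  let g : MvPolynomial σ k →ₗ[MvPolynomial σ k] monomialIdeal k (insert (h + e) A) :=
    LinearMap.toSpanSingleton _ _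
      ⟨monomial (h + e) 1, monomial_mem_monomialIdeal.2 ⟨_, Or.inl rfl, le_rfl⟩⟩
  have hg : ∀ c, (g c).1 = c * monomial (h + e) 1 := fun c => rfl
  have hsurj : Function.Surjective (N.mkQ ∘ₗ g) := by
    intro z
    obtain ⟨⟨y, hy⟩, rfl⟩ := Submodule.mkQ_surjective _ z
    obtain ⟨c, z, hz, rfl⟩ := mem_monomialIdeal_insert.1 hy
    refine ⟨c, ?_⟩
    rw [LinearMap.comp_apply, ← sub_eq_zero, ← map_sub, Submodule.mkQ_apply,
      Submodule.Quotient.mk_eq_zero]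
    change c * monomial (h + e) 1 - (c * monomial (h + e) 1 + z) ∈ monomialIdeal k A
    rw [sub_add_cancel_left]
    exact neg_mem hz
  have hker : monomialIdeal k B = LinearMap.ker (N.mkQ ∘ₗ g) := by
    ext c
    rw [LinearMap.ker_comp, Submodule.ker_mkQ, Submodule.mem_comap,
      show g c ∈ N ↔ (g c).1 ∈ monomialIdeal k A from Iff.rfl, hg, mul_monomial_mem_monomialIdeal, mem_monomialIdeal]
    exact forall₂_congr fun s _ => (hB s).symm
  exact (Submodule.quotEquivOfEq _ _ hker).trans (LinearMap.quotKerEquivOfSurjective _ hsurj)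

theorem monomialIdeal_le {A : Set (σ →₀ ℕ)} (h : 𝔪 = ⊤ ∨ (∀ x, X x ∈ 𝔪) ∧ ∀ a ∈ A, a ≠ 0) :
    monomialIdeal k A ≤ 𝔪 := by
  rcases h with rfl | ⟨hX, h0⟩
  · exact le_top
  · refine Ideal.span_le.2 ?_
    rintro _ ⟨a, ha, rfl⟩
    obtain ⟨x, hx⟩ := Finsupp.ne_iff.1 (h0 a ha)
    exact Ideal.mem_of_dvd _ (X_dvd_monomial.2 (Or.inr hx)) (hX x)

theorem hasBetti_quotient_of_monomialIdeal {A : Set (σ →₀ ℕ)} {r : ℕ}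
    (h : 𝔪 = ⊤ ∨ (∀ x, X x ∈ 𝔪) ∧ ∀ a ∈ A, a ≠ 0)
    (hA : ∀ d, HasBetti 𝔪 d (monomialIdeal k A) (r.choose (d + 1))) (d : ℕ) :
    HasBetti 𝔪 d (MvPolynomial σ k ⧸ monomialIdeal k A) (r.choose d) := by
  cases d with
  | zero =>
    rw [Nat.choose_zero_right]
    exact hasBetti_quotient_zero (monomialIdeal_le h)
  | succ d => exact hasBetti_quotient_succ (monomialIdeal_le h) (hA d)

/-- Addition of a monomial generator in the two cases of interest: for `𝔪 = ⊤` nothing is needed, and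
otherwise the new generator has a larger exponent than all others at some variable. -/
theorem hasBetti_monomialIdeal_insert_of_lt {A B : Set (σ →₀ ℕ)} {f : σ →₀ ℕ}
    (hm : 𝔪 = ⊤ ∨ (∀ x, X x ∈ 𝔪) ∧ ∃ x, 0 < f x ∧ ∀ a ∈ A, a x < f x)
    (hB : ∀ g, (∃ a ∈ A, a ≤ g + f) ↔ ∃ b ∈ B, b ≤ g)
    (h₁ : HasBetti 𝔪 d (monomialIdeal k A) b)
    (h₂ : HasBetti 𝔪 d (MvPolynomial σ k ⧸ monomialIdeal k B) b') :
    HasBetti 𝔪 d (monomialIdeal k (insert f A)) (b + b') := by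
  classical
  rcases hm with rfl | ⟨hX, x, h0, hx⟩
  -- Here `e = 0`, whose monomial `1` lies in `⊤`.
  · rw [← add_zero f]
    exact hasBetti_monomialIdeal_insert trivial (by simp) (by simpa using hB) h₁ h₂
  -- Here `e` is one factor of the variable `x`. All exponents at `x` in `A` are smaller than `f x`,
  -- so dropping it does not affect the colon ideal.
  · have hf : f - Finsupp.single x 1 + Finsupp.single x 1 = f := by
      refine tsub_add_cancel_of_le (Finsupp.single_le_iff.2 h0)
    rw [← hf] at hB ⊢
    refine hasBetti_monomialIdeal_insert (hX x) ?_ hB h₁ h₂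
    rintro g ⟨a, ha, hle⟩
    refine ⟨a, ha, fun z => ?_⟩
    have h1 := hle z
    have h2 := hx a ha
    rcases eq_or_ne z x with rfl | hz
    · simp only [Finsupp.add_apply, Finsupp.tsub_apply, Finsupp.single_eq_same] at h1 ⊢
      omega
    · simpa [Finsupp.single_apply, hz.symm] using h1

/-- The Taylor resolution. -/
theorem hasBetti_monomialIdeal_image {ι : Type*} (T : Finset ι) (a : ι → σ →₀ ℕ)
    (hm : 𝔪 = ⊤ ∨ (∀ x, X x ∈ 𝔪) ∧ ∀ i ∈ T, ∃ x, 0 < a i x ∧ ∀ j ∈ T, j ≠ i → a j x < a i x) (d : ℕ) :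
    HasBetti 𝔪 d (monomialIdeal k (a '' T)) (T.card.choose (d + 1)) := by
  classical
  induction T using Finset.induction_on generalizing a d with
  | empty =>
    have : Subsingleton (monomialIdeal k (a '' (∅ : Finset ι))) := by
      rw [monomialIdeal, Finset.coe_empty, Set.image_empty, Set.image_empty, Ideal.span_empty]
      infer_instance
    simpa using HasBetti.of_subsingleton
  | insert i T hi ih =>
    rw [Finset.coe_insert, Set.image_insert_eq, Finset.card_insert_of_notMem hi,
      Nat.choose_succ_succ, add_comm (T.card.choose d)]
    have hne : ∀ j ∈ T, j ≠ i := fun j hj h => hi (h ▸ hj)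
    -- Truncated subtraction gives `a j / gcd (a i, a j)`, the generators of the colon ideal. The
    -- ranks add up by Pascal's rule.
    refine hasBetti_monomialIdeal_insert_of_lt (B := (fun j => a j - a i) '' T) ?_ ?_ (ih a ?_ d)
      (hasBetti_quotient_of_monomialIdeal ?_ (ih _ ?_) d)
    · refine hm.imp_right fun h => ⟨h.1, ?_⟩
      obtain ⟨x, h0, hx⟩ := h.2 i (Finset.mem_insert_self i T)
      refine ⟨x, h0, ?_⟩
      rintro _ ⟨j, hj, rfl⟩
      exact hx j (Finset.mem_insert_of_mem hj) (hne j hj)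
    · intro g
      simp [tsub_le_iff_right]
    · refine hm.imp_right fun h => ⟨h.1, fun j hj => ?_⟩
      obtain ⟨x, h0, hx⟩ := h.2 j (Finset.mem_insert_of_mem hj)
      exact ⟨x, h0, fun l hl => hx l (Finset.mem_insert_of_mem hl)⟩
    · refine hm.imp_right fun h => ⟨h.1, ?_⟩
      rintro _ ⟨j, hj, rfl⟩
      obtain ⟨x, h0, hx⟩ := h.2 j (Finset.mem_insert_of_mem hj)
      have := hx i (Finset.mem_insert_self i T) (hne j hj).symm
      refine Finsupp.ne_iff.2 ⟨x, ?_⟩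
      simp only [Finsupp.tsub_apply, Finsupp.zero_apply]
      omega
    -- A variable that singles out `a j` still singles out `a j - a i`, since the same amount is
    -- subtracted from every exponent.
    · refine hm.imp_right fun h => ⟨h.1, fun j hj => ?_⟩
      obtain ⟨x, h0, hx⟩ := h.2 j (Finset.mem_insert_of_mem hj)
      have h2 := hx i (Finset.mem_insert_self i T) (hne j hj).symm
      refine ⟨x, tsub_pos_of_lt h2, fun l hl hlj => ?_⟩
      have h1 := hx l (Finset.mem_insert_of_mem hl) hlj
      simp only [Finsupp.tsub_apply]
      omega

end MonomialIdeal

/-! ### Minimal generators of monomial ideals -/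

section Minimal

open MvPolynomial

variable {k : Type u} [Field k] {σ : Type}

/-- Monomials none of which divides another are minimal generators. -/
theorem hasBetti_zero_of_antichain {ι : Type} [Fintype ι] (a : ι → σ →₀ ℕ)
    (ha : ∀ i j, a i ≤ a j → i = j) :
    HasBetti (RingHom.ker (constantCoeff (R := k) (σ := σ))) 0 (monomialIdeal k (Set.range a))
      (Fintype.card ι) := by
  classical
  let f := Fintype.linearCombination (MvPolynomial σ k) fun i => monomial (a i) (1 : k)
  have hr : LinearMap.range f = monomialIdeal k (Set.range a) := by
    rw [Fintype.range_linearCombination, monomialIdeal, ← Set.range_comp]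
    rfl
  refine ⟨ι, inferInstance, f.codRestrict _ fun y => hr.le ⟨y, rfl⟩, ⟨?_, fun y hy j => ?_⟩, rfl⟩
  · rintro ⟨y, hy⟩
    obtain ⟨z, hz⟩ := hr.ge hy
    exact ⟨z, Subtype.ext hz⟩
  · have h0 : f y = 0 := congrArg Subtype.val hy
    -- By the antichain condition only the `j`-th summand contributes at the exponent `a j`, with
    -- the constant coefficient of `y j`.
    have h1 := congrArg (coeff (a j)) h0
    rw [Fintype.linearCombination_apply, coeff_sum, coeff_zero, Finset.sum_eq_single j] at h1
    · rw [smul_eq_mul, coeff_mul_monomial', if_pos le_rfl, tsub_self, mul_one] at h1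
      exact h1
    · intro i _ hij
      rw [smul_eq_mul, coeff_mul_monomial', if_neg fun h => hij (ha i j h)]
    · exact fun h => absurd (Finset.mem_univ j) h

theorem isPrime_ker_constantCoeff :
    (RingHom.ker (constantCoeff (R := k) (σ := σ))).IsPrime :=
  RingHom.ker_isPrime _

end Minimal

/-! ### Combinatorics of deleted vertices -/

section Vertices

variable {n q : ℕ} {m : Fin q → Fin n →₀ ℕ}

/-- The exponent vector of the monomial `mᵢ mⱼ` that labels the vertex `ℓ_{i,j}`. -/
noncomputable def vertexLabel (m : Fin q → Fin n →₀ ℕ) (w : Sym2 (Fin q)) : Fin n →₀ ℕ :=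
  Sym2.lift ⟨fun i j => m i + m j, fun i j => add_comm (m i) (m j)⟩ w

theorem vertexLabel_mk (i j : Fin q) : vertexLabel m s(i, j) = m i + m j := rfl

/-- A deleted vertex has a label that is divisible by the label of another vertex. -/
theorem exists_le_of_mem_deletedVertices {w : Sym2 (Fin q)} (hw : w ∈ deletedVertices m) :
    ∃ c d, s(c, d) ≠ w ∧ m c + m d ≤ vertexLabel m w := by
  obtain ⟨i, j, u, v, hne, hle, ⟨heq, -, -, -, rfl⟩ | ⟨-, rfl⟩⟩ := hw
  · exact ⟨u, v, hne.symm, heq.ge⟩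
  · exact ⟨i, j, hne, hle⟩

/-- If `m_c m_d` divides `mᵢ²`, square-freeness makes both factors divide `mᵢ`, so `c = d = i`. -/
theorem diag_notMem_deletedVertices (h₁ : ∀ i x, m i x ≤ 1) (h₂ : ∀ i j, m i ≤ m j → i = j)
    (i : Fin q) : s(i, i) ∉ deletedVertices m := by
  intro h
  obtain ⟨c, d, hne, hle⟩ := exists_le_of_mem_deletedVertices h
  have key : ∀ c d, m c + m d ≤ m i + m i → c = i := fun c d h => h₂ _ _ fun x => by
    have := h x
    have := h₁ c x
    simp only [Finsupp.add_apply] at *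
    omega
  rw [vertexLabel_mk] at hle
  obtain rfl := key c d hle
  obtain rfl := key d c (add_comm (m c) (m d) ▸ hle)
  exact hne rfl

/-- If `mᵢ²` and the label of another vertex divide a monomial, then so does the label of a vertex
`ℓ_{i,j}` with `j ≠ i` that is not deleted. -/
theorem exists_notMem_deletedVertices (h₁ : ∀ i x, m i x ≤ 1) (h₂ : ∀ i j, m i ≤ m j → i = j)
    {i u v : Fin q} (huv : s(u, v) ≠ s(i, i)) {g : Fin n →₀ ℕ} (hg : m u + m v ≤ g + (m i + m i)) :
    ∃ j, j ≠ i ∧ s(i, j) ∉ deletedVertices m ∧ m i + m j ≤ g + (m i + m i) := by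
  classical
  have hbase : ∀ c d, m c + m d ≤ g + (m i + m i) → m c ≤ g + m i := fun c d h x => by
    have := h x
    have := h₁ c x
    simp only [Finsupp.add_apply] at *
    omega
  have hne : (Finset.univ.filter fun j => j ≠ i ∧ m j ≤ g + m i).Nonempty := by
    by_cases hu : u = i
    · have hv : v ≠ i := fun hv => huv (by rw [hu, hv])
      exact ⟨v, by simpa [hv] using hbase v u (add_comm (m u) (m v) ▸ hg)⟩
    · exact ⟨u, by simpa [hu] using hbase u v hg⟩
  -- Choose `mⱼ` with the fewest variables outside `mᵢ`. If `ℓ_{i,j}` were deleted, some `m_c m_d`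
  -- with `c, d ≠ i` would divide `mᵢ mⱼ`. A variable of `m_d` outside `mᵢ` then lies in `mⱼ` but
  -- not in `m_c`, so `c` would contradict minimality.
  obtain ⟨j, hj, hmin⟩ := Finset.exists_min_image _
    (fun j => (Finset.univ.filter fun x => m i x = 0 ∧ m j x = 1).card) hne
  simp only [Finset.mem_filter, Finset.mem_univ, true_and] at hj hmin
  refine ⟨j, hj.1, fun hdel => ?_, ?_⟩
  · obtain ⟨c, d, hcd, hle⟩ := exists_le_of_mem_deletedVertices hdel
    rw [vertexLabel_mk] at hle
    have hc : c ≠ i := by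
      rintro rfl
      exact hcd (by rw [h₂ _ _ (le_of_add_le_add_left hle)])
    have hd : d ≠ i := by
      rintro rfl
      rw [add_comm] at hle
      exact hcd (by rw [h₂ _ _ (le_of_add_le_add_left hle), Sym2.eq_swap])
    have hcg : m c ≤ g + m i := fun x => by
      have := hle x
      have := hj.2 x
      have := h₁ c x
      simp only [Finsupp.add_apply] at *
      omega
    refine (hmin c ⟨hc, hcg⟩).not_gt (Finset.card_lt_card ?_)
    obtain ⟨x, hx⟩ : ∃ x, m i x < m d x := by
      by_contra! h
      exact hd (h₂ _ _ h)
    have hxi := h₁ d x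
    rw [Finset.ssubset_iff_of_subset]
    · refine ⟨x, ?_, ?_⟩ <;> simp only [Finset.mem_filter, Finset.mem_univ, true_and]
      all_goals
        have := hle x
        have := h₁ j x
        simp only [Finsupp.add_apply] at *
        omega
    · intro y
      simp only [Finset.mem_filter, Finset.mem_univ, true_and]
      have := hle y
      have := h₁ j y
      simp only [Finsupp.add_apply] at *
      omega
  · intro x
    have := hj.2 x
    simp only [Finsupp.add_apply] at *
    omega

/-- Comparable labels force a deletion: of the larger label if they differ, and of a pair containing
the smallest index if they agree. -/
theorem eq_of_vertexLabel_le {w w' : Sym2 (Fin q)} (hw : w ∉ deletedVertices m)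
    (hw' : w' ∉ deletedVertices m) (hle : vertexLabel m w ≤ vertexLabel m w') : w = w' := by
  have sorted : ∀ w : Sym2 (Fin q), ∃ i j, i ≤ j ∧ w = s(i, j) := by
    intro w
    induction w with
    | _ i j =>
      rcases le_total i j with h | h
      · exact ⟨i, j, h, rfl⟩
      · exact ⟨j, i, h, Sym2.eq_swap⟩
  obtain ⟨i, j, hij, rfl⟩ := sorted w
  obtain ⟨u, v, huv, rfl⟩ := sorted w'
  by_contra hne
  rw [vertexLabel_mk, vertexLabel_mk] at hle
  by_cases heq : m i + m j = m u + m v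
  · rcases le_total i u with h | h
    · exact hw ⟨i, j, u, v, hne, hle, Or.inl ⟨heq, hij, h, h.trans huv, rfl⟩⟩
    · exact hw' ⟨u, v, i, j, Ne.symm hne, heq.ge, Or.inl ⟨heq.symm, huv, h, h.trans hij, rfl⟩⟩
  · exact hw' ⟨i, j, u, v, hne, hle, Or.inr ⟨heq, rfl⟩⟩

/-- Every label is divisible by the label of a vertex that is not deleted. -/
theorem exists_vertexLabel_le (h₂ : ∀ i j, m i ≤ m j → i = j) (w : Sym2 (Fin q)) :
    ∃ w', w' ∉ deletedVertices m ∧ vertexLabel m w' ≤ vertexLabel m w := by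
  classical
  -- Minimize the degree first and then maximize the smaller index. A deletion for strict
  -- divisibility lowers the degree; one for equal labels offers a pair with strictly larger
  -- minimum.
  obtain ⟨w', hw', hmin⟩ := Finset.exists_min_image
    (Finset.univ.filter fun w' => vertexLabel m w' ≤ vertexLabel m w)
    (fun w' => toLex ((vertexLabel m w').degree, q - (w'.inf : ℕ))) ⟨w, by simp⟩
  simp only [Finset.mem_filter, Finset.mem_univ, true_and] at hw' hmin
  refine ⟨w', ?_, hw'⟩
  rintro ⟨i, j, u, v, hne, hle, ⟨heq, hij, hiu, hiv, rfl⟩ | ⟨hlt, rfl⟩⟩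
  · have hu : i ≠ u := by
      rintro rfl
      exact hne (by rw [h₂ _ _ (add_left_cancel heq).le])
    have hv : i ≠ v := by
      rintro rfl
      rw [add_comm (m u)] at heq
      exact hne (by rw [h₂ _ _ (add_left_cancel heq).le, Sym2.eq_swap])
    have := hmin s(u, v) (heq.ge.trans hw')
    rw [Prod.Lex.toLex_le_toLex] at this
    rw [vertexLabel_mk, vertexLabel_mk, heq] at this
    simp only [lt_irrefl, false_or, true_and, Sym2.inf_mk] at this
    have hlt : i < u ⊓ v := lt_inf_iff.2 ⟨lt_of_le_of_ne hiu hu, lt_of_le_of_ne hiv hv⟩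
    rw [inf_eq_left.2 hij] at this
    have := Fin.lt_def.1 hlt
    omega
  · have := hmin s(i, j) (hle.trans hw')
    rw [Prod.Lex.toLex_le_toLex] at this
    have hdeg : (vertexLabel m s(i, j)).degree < (vertexLabel m s(u, v)).degree := by
      rw [Finsupp.degree_eq_sum, Finsupp.degree_eq_sum]
      obtain ⟨x, hx⟩ := Finsupp.ne_iff.1 hlt
      exact Finset.sum_lt_sum (fun y _ => hle y)
        ⟨x, Finset.mem_univ x, lt_of_le_of_ne (hle x) hx⟩
    rcases this with h | ⟨h, -⟩
    · exact hdeg.not_gt h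
    · exact hdeg.ne' h

end Vertices

/-! ### Counting the faces of `𝕃²_q` -/

section Count

variable {q : ℕ}

/-- The vertices `ℓ_{i,j}` with `j ≠ i`. -/
theorem filter_mem_not_isDiag (i : Fin q) :
    (Finset.univ.filter fun w : Sym2 (Fin q) => ¬ w.IsDiag ∧ i ∈ w) =
      (Finset.univ.erase i).image fun j => s(i, j) := by
  ext w
  simp only [Finset.mem_filter, Finset.mem_univ, true_and, Finset.mem_image, Finset.mem_erase,
    and_true]
  constructor
  · rintro ⟨hw, j, rfl⟩
    exact ⟨j, fun h => hw h.symm, rfl⟩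
  · rintro ⟨j, hj, rfl⟩
    exact ⟨fun h => hj h.symm, Sym2.mem_mk_left i j⟩

theorem card_filter_mem_not_isDiag (i : Fin q) :
    (Finset.univ.filter fun w : Sym2 (Fin q) => ¬ w.IsDiag ∧ i ∈ w).card = q - 1 := by
  rw [filter_mem_not_isDiag, Finset.card_image_of_injective _ fun a b h => Sym2.congr_right.1 h,
    Finset.card_erase_of_mem (Finset.mem_univ i), Finset.card_univ, Fintype.card_fin]

theorem card_filter_not_isDiag :
    (Finset.univ.filter fun w : Sym2 (Fin q) => ¬ w.IsDiag).card = q * (q - 1) / 2 := by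
  rw [← Fintype.card_subtype, Sym2.card_subtype_not_diag, Fintype.card_fin, Nat.choose_two_right]

theorem mem_faces_complexL2 {F : Finset (Sym2 (Fin q))} {d : ℕ} (hF : F.card = d + 1) :
    F ∈ (complexL2 q).faces ↔ (∀ w ∈ F, ¬ w.IsDiag) ∨ ∃ i, ∀ w ∈ F, i ∈ w := by
  have hne : F.Nonempty := Finset.card_pos.1 (by omega)
  simp [complexL2, complexSpannedBy, hne, Finset.subset_iff]

theorem numFaces_complexL2 (d : ℕ) :
    numFaces (complexL2 q) d = (q * (q - 1) / 2).choose (d + 1) + q * (q - 1).choose d := by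
  classical
  let N : Finset (Sym2 (Fin q)) := Finset.univ.filter fun w => ¬ w.IsDiag
  let E : Fin q → Finset (Sym2 (Fin q)) := fun i => Finset.univ.filter fun w => ¬ w.IsDiag ∧ i ∈ w
  have hE : ∀ i, s(i, i) ∉ E i := fun i h => (Finset.mem_filter.1 h).2.1 rfl
  -- Faces containing the loop `ℓ_{i,i}`: it determines `i` and excludes the face without loops, so
  -- no face is counted twice.
  let star : Fin q → Finset (Finset (Sym2 (Fin q))) := fun i =>
    ((E i).powersetCard d).image (insert s(i, i))
  have hstar : ∀ i, (star i).card = (q - 1).choose d := by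
    intro i
    rw [Finset.card_image_of_injOn, Finset.card_powersetCard, card_filter_mem_not_isDiag]
    intro F hF G hG hFG
    have hnot : ∀ F ∈ (E i).powersetCard d, s(i, i) ∉ F := fun F hF h =>
      hE i ((Finset.mem_powersetCard.1 hF).1 h)
    rw [← Finset.erase_insert (hnot F hF), ← Finset.erase_insert (hnot G hG)]
    exact congrArg (fun H => Finset.erase H s(i, i)) hFG
  have hmem : ∀ i F, F ∈ star i ↔ F.card = d + 1 ∧ s(i, i) ∈ F ∧ ∀ w ∈ F, i ∈ w := by
    intro i F
    simp only [star, Finset.mem_image, Finset.mem_powersetCard]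
    constructor
    · rintro ⟨G, ⟨hG, rfl⟩, rfl⟩
      refine ⟨Finset.card_insert_of_notMem fun h => hE i (hG h), Finset.mem_insert_self _ _, ?_⟩
      intro w hw
      rcases Finset.mem_insert.1 hw with rfl | hw
      · exact Sym2.mem_mk_left i i
      · exact (Finset.mem_filter.1 (hG hw)).2.2
    · rintro ⟨hc, hi, hF⟩
      refine ⟨F.erase s(i, i), ⟨fun w hw => ?_, ?_⟩, Finset.insert_erase hi⟩
      · obtain ⟨hne, hw⟩ := Finset.mem_erase.1 hw
        refine Finset.mem_filter.2 ⟨Finset.mem_univ _, fun hd => hne ?_, hF w hw⟩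
        obtain ⟨j, rfl⟩ := hF w hw
        rw [Sym2.mk_isDiag_iff.1 hd]
      · rw [Finset.card_erase_of_mem hi, hc, Nat.add_sub_cancel]
  have hset : {F | F ∈ (complexL2 q).faces ∧ F.card = d + 1} =
      ((N.powersetCard (d + 1) ∪ Finset.univ.biUnion star : Finset _) : Set _) := by
    ext F
    simp only [Set.mem_ofPred_eq, Finset.coe_union, Set.mem_union, Finset.mem_coe,
      Finset.mem_powersetCard, Finset.mem_biUnion, Finset.mem_univ, true_and, hmem]
    constructor
    · rintro ⟨hF, hc⟩
      by_cases hd : ∀ w ∈ F, ¬ w.IsDiag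
      · exact Or.inl ⟨fun w hw => Finset.mem_filter.2 ⟨Finset.mem_univ _, hd w hw⟩, hc⟩
      · obtain ⟨i, hi⟩ := ((mem_faces_complexL2 hc).1 hF).resolve_left hd
        push Not at hd
        obtain ⟨w, hw, hwd⟩ := hd
        obtain ⟨j, rfl⟩ := hi w hw
        obtain rfl : i = j := hwd
        exact Or.inr ⟨i, hc, hw, hi⟩
    · rintro (⟨hF, hc⟩ | ⟨i, hc, -, hi⟩)
      · exact ⟨(mem_faces_complexL2 hc).2 (Or.inl fun w hw => (Finset.mem_filter.1 (hF hw)).2), hc⟩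
      · exact ⟨(mem_faces_complexL2 hc).2 (Or.inr ⟨i, hi⟩), hc⟩
  rw [numFaces, hset, Set.ncard_coe_finset, Finset.card_union_of_disjoint, Finset.card_powersetCard,
    card_filter_not_isDiag, Finset.card_biUnion, Finset.sum_congr rfl fun i _ => hstar i,
    Finset.sum_const, Finset.card_univ, Fintype.card_fin, smul_eq_mul]
  · intro i _ j _ hij
    refine Finset.disjoint_left.2 ?_
    intro F hi hj
    have := ((hmem j F).1 hj).2.2 _ ((hmem i F).1 hi).2.1
    exact hij ((Sym2.mem_iff.1 this).elim Eq.symm Eq.symm)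
  · rw [Finset.disjoint_left]
    intro F hF hF'
    obtain ⟨i, -, hi⟩ := Finset.mem_biUnion.1 hF'
    exact (Finset.mem_filter.1 ((Finset.mem_powersetCard.1 hF).1 ((hmem i F).1 hi).2.1)).2 rfl

end Count

/-! ### The resolution of the square; extremal ideals -/

section Square

open MvPolynomial

variable {k : Type u} [Field k] {n q : ℕ} {m : Fin q → Fin n →₀ ℕ}

open Classical in
/-- The vertices `ℓ_{i,j}`, `i ≠ j`, that are not deleted. -/
noncomputable def keptEdges (m : Fin q → Fin n →₀ ℕ) : Finset (Sym2 (Fin q)) :=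
  Finset.univ.filter fun w => ¬ w.IsDiag ∧ w ∉ deletedVertices m

theorem mem_keptEdges {w : Sym2 (Fin q)} :
    w ∈ keptEdges m ↔ ¬ w.IsDiag ∧ w ∉ deletedVertices m := by
  simp [keptEdges]

/-- For every vertex `w` there is a variable that divides exactly the generators `mⱼ` with `j ∈ w`.
This holds for the extremal ideals. -/
def IsExtremal (m : Fin q → Fin n →₀ ℕ) : Prop :=
  ∀ w : Sym2 (Fin q), ∃ x, ∀ j, m j x = if j ∈ w then 1 else 0

/-- The exponent of the variable of `w` in the label of `w'` counts the endpoints of `w'` in `w`. -/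
theorem IsExtremal.exists_variable_edge (hm : IsExtremal m) {w : Sym2 (Fin q)} (hw : ¬ w.IsDiag) :
    ∃ x, vertexLabel m w x = 2 ∧ ∀ w', w' ≠ w → ¬ w'.IsDiag → vertexLabel m w' x < 2 := by
  obtain ⟨x, hx⟩ := hm w
  refine ⟨x, ?_, fun w' hne hw' => ?_⟩
  · induction w with
    | _ i j => simp [vertexLabel_mk, hx]
  · induction w' with
    | _ u v =>
      rw [vertexLabel_mk, Finsupp.add_apply, hx, hx]
      by_cases hu : u ∈ w <;> by_cases hv : v ∈ w <;> simp only [hu, hv, if_true, if_false]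
      · exact absurd ((Sym2.mem_and_mem_iff hw').1 ⟨hu, hv⟩).symm hne
      all_goals norm_num

theorem IsExtremal.exists_variable_diag (hm : IsExtremal m) (i : Fin q) :
    ∃ x, ∀ j, m j x = if j = i then 1 else 0 := by
  simpa using hm s(i, i)

variable {𝔪 : Ideal (MvPolynomial (Fin n) k)}

theorem hasBetti_keptEdges (hm : 𝔪 = ⊤ ∨ (∀ x, X x ∈ 𝔪) ∧ IsExtremal m) (d : ℕ) :
    HasBetti 𝔪 d (monomialIdeal k (vertexLabel m '' keptEdges m))
      ((keptEdges m).card.choose (d + 1)) := by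
  refine hasBetti_monomialIdeal_image _ _ (hm.imp_right fun h => ⟨h.1, fun w hw => ?_⟩) d
  obtain ⟨x, hx, hlt⟩ := h.2.exists_variable_edge (mem_keptEdges.1 hw).1
  refine ⟨x, by omega, fun w' hw' hne => ?_⟩
  rw [hx]
  exact hlt w' hne (mem_keptEdges.1 hw').1

open Classical in
-- In the extremal case the generator from `ℓ_{i,j}` is singled out by the variable of `ℓ_{j,j}`,
-- which divides `mⱼ` alone.
theorem hasBetti_quotient_colon (hm : 𝔪 = ⊤ ∨ (∀ x, X x ∈ 𝔪) ∧ IsExtremal m) (i : Fin q) (d : ℕ) :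
    HasBetti 𝔪 d (MvPolynomial (Fin n) k ⧸ monomialIdeal k
      ((fun w => vertexLabel m w - (m i + m i)) '' ((keptEdges m).filter fun w => i ∈ w)))
      (((keptEdges m).filter fun w => i ∈ w).card.choose d) := by
  have hvar : IsExtremal m → ∀ w ∈ (keptEdges m).filter fun w => i ∈ w,
      ∃ x, 0 < (vertexLabel m w - (m i + m i)) x ∧
        ∀ w' ∈ (keptEdges m).filter fun w => i ∈ w, w' ≠ w →
          (vertexLabel m w' - (m i + m i)) x < (vertexLabel m w - (m i + m i)) x := by
    intro h w hw
    obtain ⟨hw, j, rfl⟩ := Finset.mem_filter.1 hw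
    have hij : i ≠ j := (mem_keptEdges.1 hw).1
    obtain ⟨x, hx⟩ := h.exists_variable_diag j
    refine ⟨x, by simp [vertexLabel_mk, hx, hij], fun w' hw' hne => ?_⟩
    obtain ⟨hw', l, rfl⟩ := Finset.mem_filter.1 hw'
    have hlj : l ≠ j := fun hl => hne (by rw [hl])
    simp [vertexLabel_mk, hx, hij, hlj]
  refine hasBetti_quotient_of_monomialIdeal (hm.imp_right fun h => ⟨h.1, ?_⟩)
    (hasBetti_monomialIdeal_image _ _ (hm.imp_right fun h => ⟨h.1, hvar h.2⟩)) d
  rintro _ ⟨w, hw, rfl⟩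
  obtain ⟨x, hx, -⟩ := hvar h.2 w hw
  exact Finsupp.ne_iff.2 ⟨x, hx.ne'⟩

open Classical in
theorem hasBetti_keptEdges_union (h₁ : ∀ i x, m i x ≤ 1) (h₂ : ∀ i j, m i ≤ m j → i = j)
    (hm : 𝔪 = ⊤ ∨ (∀ x, X x ∈ 𝔪) ∧ IsExtremal m) (A : Finset (Fin q)) (d : ℕ) :
    HasBetti 𝔪 d (monomialIdeal k (vertexLabel m '' keptEdges m ∪ (fun i => m i + m i) '' A))
      ((keptEdges m).card.choose (d + 1)
        + ∑ i ∈ A, ((keptEdges m).filter fun w => i ∈ w).card.choose d) := by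
  induction A using Finset.induction_on with
  | empty =>
    rw [Finset.coe_empty, Set.image_empty, Set.union_empty, Finset.sum_empty, add_zero]
    exact hasBetti_keptEdges hm d
  | insert i A hi ih =>
    rw [Finset.coe_insert, Set.image_insert_eq, Set.union_insert, Finset.sum_insert hi,
      add_comm (Nat.choose _ d), ← add_assoc]
    refine hasBetti_monomialIdeal_insert_of_lt (hm.imp_right fun h => ⟨h.1, ?_⟩) (fun g => ?_) ih
      (hasBetti_quotient_colon hm i d)
    -- The variable of `ℓ_{i,i}` has exponent 2 in `mᵢ²`, at most 1 in the labels of edges, and 0 in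
    -- the other squares.
    · obtain ⟨x, hx⟩ := h.2.exists_variable_diag i
      refine ⟨x, by simp [hx], ?_⟩
      rintro _ (⟨w, hw, rfl⟩ | ⟨j, hj, rfl⟩)
      · have hw := (mem_keptEdges.1 hw).1
        induction w with
        | _ u v =>
          have huv : u ≠ v := hw
          rw [vertexLabel_mk, Finsupp.add_apply, Finsupp.add_apply, hx, hx, hx, if_pos rfl]
          split_ifs with hu hv
          · exact absurd (hu.trans hv.symm) huv
          all_goals norm_num
      · have hji : j ≠ i := fun h => hi (h ▸ hj)
        simp [hx, hji]
    -- The colon ideal depends only on the star of `i`, not on the squares already added.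
    · have key : ∀ u v, s(u, v) ≠ s(i, i) → m u + m v ≤ g + (m i + m i) →
          ∃ b ∈ (fun w => vertexLabel m w - (m i + m i)) ''
            ((keptEdges m).filter fun w => i ∈ w), b ≤ g := by
        intro u v huv hle
        obtain ⟨j, hji, hj, hle⟩ := exists_notMem_deletedVertices h₁ h₂ huv hle
        refine ⟨_, ⟨s(i, j), ?_, rfl⟩, tsub_le_iff_right.2 hle⟩
        simp [mem_keptEdges, hj, hji.symm]
      constructor
      · rintro ⟨_, ⟨w, hw, rfl⟩ | ⟨j, hj, rfl⟩, hle⟩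
        · have hw := (mem_keptEdges.1 hw).1
          induction w with
          | _ u v => exact key u v (fun h => hw (h ▸ rfl)) hle
        · exact key j j (fun h => hi ((show j = i by simpa using h) ▸ hj)) hle
      · rintro ⟨_, ⟨w, hw, rfl⟩, hle⟩
        exact ⟨_, Or.inl ⟨w, (Finset.mem_filter.1 hw).1, rfl⟩, tsub_le_iff_right.1 hle⟩

theorem monomialIdeal_range_vertexLabel (h₂ : ∀ i j, m i ≤ m j → i = j) {A : Set (Fin n →₀ ℕ)}
    (hA : ∀ a ∈ A, a ∈ Set.range (vertexLabel m))
    (hA' : ∀ w, w ∉ deletedVertices m → vertexLabel m w ∈ A) :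
    monomialIdeal k A = monomialIdeal k (Set.range (vertexLabel m)) := by
  refine le_antisymm (monomialIdeal_mono fun a ha => ⟨a, hA a ha, le_rfl⟩) (monomialIdeal_mono ?_)
  rintro _ ⟨w, rfl⟩
  obtain ⟨w', hw', hle⟩ := exists_vertexLabel_le h₂ w
  exact ⟨_, hA' w' hw', hle⟩

theorem monomialIdeal_range_sq :
    monomialIdeal k (Set.range m) ^ 2 = monomialIdeal k (Set.range (vertexLabel m)) := by
  rw [pow_two, monomialIdeal, Ideal.span_mul_span', monomialIdeal]
  congr 1
  ext y
  constructor
  · rintro ⟨_, ⟨_, ⟨i, rfl⟩, rfl⟩, _, ⟨_, ⟨j, rfl⟩, rfl⟩, rfl⟩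
    exact ⟨_, ⟨s(i, j), rfl⟩, by simp [vertexLabel_mk, monomial_mul]⟩
  · rintro ⟨_, ⟨w, rfl⟩, rfl⟩
    induction w with
    | _ i j =>
      exact ⟨_, ⟨_, ⟨i, rfl⟩, rfl⟩, _, ⟨_, ⟨j, rfl⟩, rfl⟩, by simp [vertexLabel_mk, monomial_mul]⟩

open Classical in
/-- The Betti numbers of the resolution of `I ^ 2`. -/
theorem hasBetti_sq (h₁ : ∀ i x, m i x ≤ 1) (h₂ : ∀ i j, m i ≤ m j → i = j)
    (hm : 𝔪 = ⊤ ∨ (∀ x, X x ∈ 𝔪) ∧ IsExtremal m) (d : ℕ) :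
    HasBetti 𝔪 d ↥(monomialIdeal k (Set.range m) ^ 2)
      ((keptEdges m).card.choose (d + 1)
        + ∑ i, ((keptEdges m).filter fun w => i ∈ w).card.choose d) := by
  rw [monomialIdeal_range_sq, ← monomialIdeal_range_vertexLabel h₂
    (A := vertexLabel m '' keptEdges m ∪ (fun i => m i + m i) '' (Finset.univ : Finset (Fin q)))]
  · exact hasBetti_keptEdges_union h₁ h₂ hm Finset.univ d
  · rintro _ (⟨w, -, rfl⟩ | ⟨i, -, rfl⟩)
    · exact ⟨w, rfl⟩
    · exact ⟨s(i, i), rfl⟩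
  · intro w hw
    by_cases hd : w.IsDiag
    · induction w with
      | _ i j =>
        obtain rfl : i = j := hd
        exact Or.inr ⟨i, by simp, rfl⟩
    · exact Or.inl ⟨w, mem_keptEdges.2 ⟨hd, hw⟩, rfl⟩

/-- The labels of undeleted vertices generate the square and form an antichain, hence are minimal
generators; all `q` loops are among these vertices. -/
theorem card_keptEdges_add_le_spanFinrank (h₁ : ∀ i x, m i x ≤ 1) (h₂ : ∀ i j, m i ≤ m j → i = j) :
    (keptEdges m).card + q ≤ (monomialIdeal k (Set.range m) ^ 2).spanFinrank := by
  classical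
  have hB := hasBetti_zero_of_antichain (k := k)
    (fun w : {w : Sym2 (Fin q) // w ∉ deletedVertices m} => vertexLabel m w.1)
    fun w w' h => Subtype.ext (eq_of_vertexLabel_le w.2 w'.2 h)
  have hA : ∀ a ∈ Set.range fun w : {w : Sym2 (Fin q) // w ∉ deletedVertices m} =>
      vertexLabel m w.1, a ∈ Set.range (vertexLabel m) := by
    rintro _ ⟨w, rfl⟩
    exact ⟨w, rfl⟩
  rw [monomialIdeal_range_vertexLabel h₂ hA fun w hw => ⟨⟨w, hw⟩, rfl⟩,
    ← monomialIdeal_range_sq] at hB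
  have := isPrime_ker_constantCoeff (k := k) (σ := Fin n)
  refine le_trans ?_ (hB.le_of_minimal (hasBetti_spanFinrank (IsNoetherian.noetherian _)))
  rw [Fintype.card_subtype]
  calc (keptEdges m).card + q
      = (keptEdges m ∪ Finset.univ.image fun i : Fin q => s(i, i)).card := by
        rw [Finset.card_union_of_disjoint, Finset.card_image_of_injective, Finset.card_univ,
          Fintype.card_fin]
        · exact fun i j h => by simpa using h
        · rw [Finset.disjoint_left]
          intro w hw hw'
          obtain ⟨i, -, rfl⟩ := Finset.mem_image.1 hw'
          exact (mem_keptEdges.1 hw).1 rfl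
    _ ≤ _ := by
        refine Finset.card_le_card fun w hw => Finset.mem_filter.2 ⟨Finset.mem_univ w, ?_⟩
        rcases Finset.mem_union.1 hw with hw | hw
        · exact (mem_keptEdges.1 hw).2
        · obtain ⟨i, -, rfl⟩ := Finset.mem_image.1 hw
          exact diag_notMem_deletedVertices h₁ h₂ i

theorem card_keptEdges_le : (keptEdges m).card ≤ q * (q - 1) / 2 := by
  rw [← card_filter_not_isDiag]
  exact Finset.card_le_card fun w hw => by simp [(mem_keptEdges.1 hw).1]

open Classical in
-- Loops are never deleted, so the `q - 1` edges at `i` split into kept and deleted ones.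
theorem card_keptEdges_filter_add (h₁ : ∀ i x, m i x ≤ 1) (h₂ : ∀ i j, m i ≤ m j → i = j)
    (i : Fin q) : ((keptEdges m).filter fun w => i ∈ w).card + numDeletedAt m i = q - 1 := by
  rw [← card_filter_mem_not_isDiag i, numDeletedAt, Set.ncard_eq_toFinset_card', add_comm,
    ← Finset.card_union_of_disjoint]
  · congr 1
    ext w
    simp only [Finset.mem_union, Set.mem_toFinset, Set.mem_ofPred_eq, Finset.mem_filter,
      mem_keptEdges, Finset.mem_univ, true_and]
    have : w ∈ deletedVertices m → ¬ w.IsDiag := by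
      intro hw hd
      induction w with
      | _ u v =>
        obtain rfl : u = v := hd
        exact diag_notMem_deletedVertices h₁ h₂ u hw
    tauto
  · rw [Finset.disjoint_left]
    intro w hw hw'
    exact (mem_keptEdges.1 (Finset.mem_filter.1 hw').1).2 (Set.mem_toFinset.1 hw).1

/-- The variables of the loops recover the indices of a product from its exponents, with
multiplicity, so no label divides another. -/
theorem IsExtremal.deletedVertices_eq_empty (hm : IsExtremal m) : deletedVertices m = ∅ := by
  have key : ∀ i j u v, m i + m j ≤ m u + m v → s(i, j) = s(u, v) := by
    have hmem : ∀ i j u v, m i + m j ≤ m u + m v → i = u ∨ i = v := by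
      intro i j u v h
      obtain ⟨x, hx⟩ := hm.exists_variable_diag i
      have := h x
      rw [Finsupp.add_apply, Finsupp.add_apply, hx, hx, hx, hx, if_pos rfl] at this
      by_contra! hne
      rw [if_neg hne.1.symm, if_neg hne.2.symm] at this
      omega
    intro i j u v h
    have hi := hmem i j u v h
    have hj := hmem j i u v (add_comm (m i) (m j) ▸ h)
    by_cases hij : i = j
    · subst hij
      obtain ⟨x, hx⟩ := hm.exists_variable_diag i
      have := h x
      rw [Finsupp.add_apply, Finsupp.add_apply, hx, hx, hx, if_pos rfl] at this
      split_ifs at this with hu hv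
      · rw [hu, hv]
      all_goals omega
    · have : i ∈ s(u, v) ∧ j ∈ s(u, v) := by simpa using ⟨hi, hj⟩
      exact ((Sym2.mem_and_mem_iff hij).1 this).symm
  refine Set.eq_empty_of_forall_notMem ?_
  rintro w ⟨i, j, u, v, hne, hle, -⟩
  exact hne (key i j u v hle)

theorem IsMinimallyGeneratedBySquarefree.eq_monomialIdeal {I : Ideal (MvPolynomial (Fin n) k)}
    (h : IsMinimallyGeneratedBySquarefree I m) : I = monomialIdeal k (Set.range m) := by
  rw [← h.span_eq, monomialIdeal, ← Set.range_comp]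
  rfl

theorem monomial_mem_span_others {i : Fin q} :
    monomial (m i) (1 : k) ∈ Ideal.span ((fun j => monomial (m j) (1 : k)) '' {j | j ≠ i}) ↔
      ∃ j, j ≠ i ∧ m j ≤ m i := by
  rw [← Set.image_image (fun a => monomial a (1 : k)) m]
  refine monomial_mem_monomialIdeal.trans ?_
  simp

theorem IsMinimallyGeneratedBySquarefree.eq_of_le {I : Ideal (MvPolynomial (Fin n) k)}
    (h : IsMinimallyGeneratedBySquarefree I m) (i j : Fin q) (hij : m i ≤ m j) : i = j := by
  by_contra hne
  exact h.minimal j (monomial_mem_span_others.2 ⟨i, hne, hij⟩)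

variable (k) in
theorem IsExtremal.isMinimallyGenerated (hm : IsExtremal m) (h₁ : ∀ i x, m i x ≤ 1) :
    IsMinimallyGeneratedBySquarefree (monomialIdeal k (Set.range m)) m where
  squarefree := h₁
  span_eq := by
    rw [monomialIdeal, ← Set.range_comp]
    rfl
  minimal i hi := by
    obtain ⟨j, hji, hle⟩ := monomial_mem_span_others.1 hi
    obtain ⟨x, hx⟩ := hm.exists_variable_diag j
    have := hle x
    rw [hx, hx, if_pos rfl, if_neg hji.symm] at this
    omega

theorem exists_isExtremal (q : ℕ) :
    ∃ (n : ℕ) (m : Fin q → Fin n →₀ ℕ), IsExtremal m ∧ ∀ i x, m i x ≤ 1 := by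
  classical
  let e := Fintype.equivFin (Sym2 (Fin q))
  refine ⟨_, fun i => Finsupp.equivFunOnFinite.symm fun x => if i ∈ e.symm x then 1 else 0,
    fun w => ⟨e w, fun j => ?_⟩, fun i x => ?_⟩
  · rw [Finsupp.equivFunOnFinite_symm_apply_apply, Equiv.symm_apply_apply]
  · rw [Finsupp.equivFunOnFinite_symm_apply_apply]
    split_ifs <;> norm_num

end Square

theorem theorem4p1 (k : Type*) [Field k] (q : ℕ) (hq : 2 ≤ q) :
    -- the right-hand side of (a) is the number of `d`-dimensional faces of `𝕃²_q`
    (∀ d : ℕ, numFaces (complexL2 q) d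
      = (q * (q - 1) / 2).choose (d + 1) + q * (q - 1).choose d) ∧
    -- the bounds (a) and (b)
    (∀ (n : ℕ) (I : Ideal (MvPolynomial (Fin n) k)) (m : Fin q → Fin n →₀ ℕ),
      IsMinimallyGeneratedBySquarefree I m → ∀ d : ℕ,
        bettiNumber (MvPolynomial (Fin n) k) ↥(I ^ 2) d
          ≤ (((q * (q - 1) / 2).choose (d + 1) + q * (q - 1).choose d : ℕ) : ℕ∞) ∧
        bettiNumber (MvPolynomial (Fin n) k) ↥(I ^ 2) d
          ≤ ((((I ^ 2).spanFinrank - q).choose (d + 1)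
              + ∑ i : Fin q, (q - 1 - numDeletedAt m i).choose d : ℕ) : ℕ∞)) ∧
    -- the bound (a) is sharp: some ideal attains it for all `d` at once
    (∃ (n : ℕ) (I : Ideal (MvPolynomial (Fin n) k)) (m : Fin q → Fin n →₀ ℕ),
      IsMinimallyGeneratedBySquarefree I m ∧ ∀ d : ℕ,
        bettiNumber (MvPolynomial (Fin n) k) ↥(I ^ 2) d
          = (((q * (q - 1) / 2).choose (d + 1) + q * (q - 1).choose d : ℕ) : ℕ∞)) := by
  classical
  have bound_a : ∀ (n : ℕ) (I : Ideal (MvPolynomial (Fin n) k)) (m : Fin q → Fin n →₀ ℕ),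
      IsMinimallyGeneratedBySquarefree I m → ∀ d : ℕ,
        bettiNumber (MvPolynomial (Fin n) k) ↥(I ^ 2) d
          ≤ (((q * (q - 1) / 2).choose (d + 1) + q * (q - 1).choose d : ℕ) : ℕ∞) := by
    intro n I m h d
    obtain rfl := h.eq_monomialIdeal
    refine (bettiNumber_le_of_hasBetti
      (hasBetti_sq h.squarefree h.eq_of_le (Or.inl rfl) d)).trans (Nat.cast_le.2 ?_)
    refine add_le_add (Nat.choose_le_choose _ card_keptEdges_le) ?_
    refine (Finset.sum_le_card_nsmul _ _ ((q - 1).choose d) fun i _ =>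
      Nat.choose_le_choose _ ?_).trans (by simp)
    exact (Nat.le_add_right _ _).trans (card_keptEdges_filter_add h.squarefree h.eq_of_le i).le
  refine ⟨numFaces_complexL2, fun n I m h d => ⟨bound_a n I m h d, ?_⟩, ?_⟩
  · obtain rfl := h.eq_monomialIdeal
    refine (bettiNumber_le_of_hasBetti
      (hasBetti_sq h.squarefree h.eq_of_le (Or.inl rfl) d)).trans (Nat.cast_le.2 ?_)
    refine add_le_add (Nat.choose_le_choose _ (Nat.le_sub_of_add_le
      (card_keptEdges_add_le_spanFinrank h.squarefree h.eq_of_le))) ?_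
    exact Finset.sum_le_sum fun i _ => Nat.choose_le_choose _ (Nat.le_sub_of_add_le
      (card_keptEdges_filter_add h.squarefree h.eq_of_le i).le)
  · obtain ⟨n, m, hm, h₁⟩ := exists_isExtremal q
    have h := hm.isMinimallyGenerated k h₁
    refine ⟨n, _, m, h, fun d => le_antisymm (bound_a n _ m h d) ?_⟩
    have := isPrime_ker_constantCoeff (k := k) (σ := Fin n)
    refine le_trans (Nat.cast_le.2 ?_) (le_bettiNumber_of_hasBetti (hasBetti_sq h₁ h.eq_of_le
      (𝔪 := RingHom.ker (MvPolynomial.constantCoeff (R := k) (σ := Fin n)))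
      (Or.inr ⟨fun x => MvPolynomial.constantCoeff_X (R := k) x, hm⟩) d))
    -- Nothing is deleted, so all edges are kept and the ranks reach the bound (a).
    have hempty := hm.deletedVertices_eq_empty
    have hdel : ∀ i, numDeletedAt m i = 0 := fun i => by simp [numDeletedAt, hempty]
    have hcard : (keptEdges m).card = q * (q - 1) / 2 := by
      rw [← card_filter_not_isDiag]
      congr 1
      ext w
      simp [mem_keptEdges, hempty]
    have hstar : ∀ i, ((keptEdges m).filter fun w => i ∈ w).card = q - 1 := fun i => by
      rw [← card_keptEdges_filter_add h₁ h.eq_of_le i, hdel, add_zero]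
    simp [hcard, hstar]
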